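/- Let $n\ge 1$, let $(a_{i,j})_{1\le i,j\le n}$ be an array of non-negative real numbers, let $\Pi_n$ be a uniformly distributed random permutation of $\{1,\dots,n\}$, and put $Z_n=\sum_{i=1}^n a_{i,\Pi_n(i)}$. Let $\operatorname{med}(Z_n)$ be any median of $Z_n$, that is, any real number with $\mathbb P(Z_n\ge \operatorname{med}(Z_n))\ge 1/2$ and $\mathbb P(Z_n\le \operatorname{med}(Z_n))\ge 1/2$. Then, for all $t>0$, provided that the $a_{i,j}$ are not all zero, $$\mathbb P\Big(\sqrt{Z_n}\ \ge\ \sqrt{\operatorname{med}(Z_n)}+t\sqrt{\max_{1\le i,j\le n}a_{i,j}}\Big)\le 2e^{-t^2/16}$$ and $$\mathbb P\Big(\sqrt{Z_n}\ \le\ \sqrt{\operatorname{med}(Z_n)}-t\sqrt{\max_{1\le i,j\le n}a_{i,j}}\Big)\le 2e^{-t^2/16}.$$ Moreover, for all $t>0$ (also if all $a_{i,j}$ are zero), $$\mathbb P\Big(\big|\sqrt{Z_n}-\sqrt{\operatorname{med}(Z_n)}\big|>t\sqrt{\max_{1\le i,j\le n}a_{i,j}}\Big)\le 4e^{-t^2/16}.$$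 -/

import Mathlib

open MeasureTheory

noncomputable section

/-- `Perm` is a random uniform permutation of an `n`-element set, defined on `(Ω, P)`: a random
variable which takes each of the `n!` permutations as its value with probability `1 / n!`. -/
structure IsUniformPermutation {n : ℕ} {Ω : Type*} [MeasurableSpace Ω] (P : Measure Ω)
    (Perm : Ω → Equiv.Perm (Fin n)) : Prop where
  measurableSet_eq : ∀ π : Equiv.Perm (Fin n), MeasurableSet {ω | Perm ω = π}
  prob_eq : ∀ π : Equiv.Perm (Fin n), P.real {ω | Perm ω = π} = 1 / (n.factorial : ℝ)

/-- The permuted sum `∑ i, a i (π i)`. -/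
def permutedSum {n : ℕ} (a : Fin n → Fin n → ℝ) (π : Equiv.Perm (Fin n)) : ℝ :=
  ∑ i, a i (π i)

/-- The largest entry of a non-empty square array. -/
def maxEntry {n : ℕ} [NeZero n] (a : Fin n → Fin n → ℝ) : ℝ :=
  Finset.univ.sup' Finset.univ_nonempty (fun p : Fin n × Fin n => a p.1 p.2)

/-- `m` is a median of the real random variable `X`:
`P(X ≥ m) ≥ 1/2` and `P(X ≤ m) ≥ 1/2`. -/
def IsMedian {Ω : Type*} [MeasurableSpace Ω] (P : Measure Ω) (X : Ω → ℝ) (m : ℝ) : Prop :=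
  1 / 2 ≤ P.real {ω | m ≤ X ω} ∧ 1 / 2 ≤ P.real {ω | X ω ≤ m}

end

/-! The method is Chatterjee's exchangeable pairs. Scale the entries into `[0, 1]`, write `Z` for
the permuted sum and `μ` for its mean, and compare `π` with `π * swap i j`. Summed over `i` and `j`,
the increments of `Z` give `2n(Z - μ)`, while their squares give at most `4n(Z + μ)`: the variance
proxy is self-bounding.

Symmetrising over the pair turns this into a differential inequality for `M(θ) = ∑ exp(θ(Z - μ))`,
namely `|M'| ≤ |θ|(M' + 2μM)` (`abs_expSumDeriv_le`). Integrating it and applying Chernoff's bound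
gives tails `exp(-s²/(4μ + 2s))` above `μ` and `exp(-s²/(4μ))` below.

On the square-root scale these are Gaussian around `√μ`, with exponents `t²/2` and `t²/4` free of
`μ`. Recentring at a median adds the denominators (`measureReal_median_add_le`), so the exponent is
`t²/6`, stronger than `t²/16`. -/

/-- The mean `(∑ i, ∑ j, a i j) / n` of the permuted sum under a uniform random permutation. -/
noncomputable def permutedMean {n : ℕ} (a : Fin n → Fin n → ℝ) : ℝ :=
  (∑ i, ∑ j, a i j) / n

/-! ### Increments under a random transposition -/

lemma permutedSum_sub_permutedSum_mul_swap {n : ℕ} (a : Fin n → Fin n → ℝ)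
    (π : Equiv.Perm (Fin n)) (i j : Fin n) :
    permutedSum a π - permutedSum a (π * Equiv.swap i j) =
      (a i (π i) + a j (π j)) - (a i (π j) + a j (π i)) := by
  rcases eq_or_ne i j with rfl | hij
  · rw [Equiv.swap_self, ← Equiv.Perm.one_def, mul_one]
    ring
  · unfold permutedSum
    rw [← Finset.sum_sub_distrib, Fintype.sum_eq_add i j hij]
    · simp; ring
    · rintro x ⟨hi, hj⟩
      simp [Equiv.swap_apply_of_ne_of_ne hi hj]

lemma permutedSum_nonneg {n : ℕ} {a : Fin n → Fin n → ℝ} (ha : ∀ i j, 0 ≤ a i j)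
    (π : Equiv.Perm (Fin n)) : 0 ≤ permutedSum a π :=
  Finset.sum_nonneg fun _ _ => ha _ _

lemma permutedMean_nonneg {n : ℕ} {a : Fin n → Fin n → ℝ} (ha : ∀ i j, 0 ≤ a i j) :
    0 ≤ permutedMean a :=
  div_nonneg (Finset.sum_nonneg fun _ _ => Finset.sum_nonneg fun _ _ => ha _ _) (by positivity)

lemma sum_sum_diagonal_add {n : ℕ} (a : Fin n → Fin n → ℝ) (π : Equiv.Perm (Fin n)) :
    ∑ i, ∑ j, (a i (π i) + a j (π j)) = 2 * n * permutedSum a π := by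
  simp only [Finset.sum_add_distrib, Finset.sum_const, Finset.card_univ, Fintype.card_fin,
    nsmul_eq_mul, ← Finset.mul_sum]
  unfold permutedSum
  ring

lemma sum_sum_offDiagonal_add {n : ℕ} [NeZero n] (a : Fin n → Fin n → ℝ)
    (π : Equiv.Perm (Fin n)) :
    ∑ i, ∑ j, (a i (π j) + a j (π i)) = 2 * n * permutedMean a := by
  have h : ∑ i, ∑ j, a i (π j) = ∑ i, ∑ j, a i j :=
    Finset.sum_congr rfl fun i _ => Equiv.sum_comp π (a i)
  have hn : (n : ℝ) ≠ 0 := by exact_mod_cast NeZero.ne n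
  simp only [Finset.sum_add_distrib]
  rw [Finset.sum_comm (f := fun i j => a j (π i)), h, permutedMean]
  field_simp
  ring

lemma sum_sum_permutedSum_sub {n : ℕ} [NeZero n] (a : Fin n → Fin n → ℝ)
    (π : Equiv.Perm (Fin n)) :
    ∑ i, ∑ j, (permutedSum a π - permutedSum a (π * Equiv.swap i j)) =
      2 * n * (permutedSum a π - permutedMean a) := by
  simp only [permutedSum_sub_permutedSum_mul_swap]
  simp only [Finset.sum_sub_distrib (f := fun j => a _ (π _) + a j (π j))]
  rw [Finset.sum_sub_distrib, sum_sum_diagonal_add, sum_sum_offDiagonal_add]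
  ring

lemma sum_sum_permutedSum_sub_sq_le {n : ℕ} [NeZero n] {a : Fin n → Fin n → ℝ}
    (ha : ∀ i j, 0 ≤ a i j) (ha' : ∀ i j, a i j ≤ 1) (π : Equiv.Perm (Fin n)) :
    ∑ i, ∑ j, (permutedSum a π - permutedSum a (π * Equiv.swap i j)) ^ 2 ≤
      4 * n * (permutedSum a π + permutedMean a) := by
  have h : ∀ i j, (permutedSum a π - permutedSum a (π * Equiv.swap i j)) ^ 2 ≤
      2 * ((a i (π i) + a j (π j)) + (a i (π j) + a j (π i))) := fun i j => by
    rw [permutedSum_sub_permutedSum_mul_swap]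
    have hx := add_nonneg (ha i (π i)) (ha j (π j))
    have hy := add_nonneg (ha i (π j)) (ha j (π i))
    have hx' := add_le_add (ha' i (π i)) (ha' j (π j))
    have hy' := add_le_add (ha' i (π j)) (ha' j (π i))
    generalize a i (π i) + a j (π j) = x at *
    generalize a i (π j) + a j (π i) = y at *
    -- For `x, y ∈ [0, 2]`, `(x - y)² ≤ x² + y² ≤ 2(x + y)`.
    nlinarith [mul_nonneg hx hy]
  refine (Finset.sum_le_sum fun i _ => Finset.sum_le_sum fun j _ => h i j).trans_eq ?_
  simp only [← Finset.mul_sum]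
  simp only [Finset.sum_add_distrib (f := fun j => a _ (π _) + a j (π j))]
  rw [Finset.sum_add_distrib, sum_sum_diagonal_add, sum_sum_offDiagonal_add]
  ring

/-! ### Symmetrisation of the exponential moment -/

lemma two_mul_exp_sub_one_le {d : ℝ} (hd : 0 ≤ d) :
    2 * (Real.exp d - 1) ≤ d * (Real.exp d + 1) := by
  have hder : ∀ x : ℝ, HasDerivAt (fun x => x * (Real.exp x + 1) - 2 * (Real.exp x - 1))
      (1 * (Real.exp x + 1) + x * Real.exp x - 2 * Real.exp x) x := fun x =>
    ((hasDerivAt_id x).mul ((Real.hasDerivAt_exp x).add_const 1)).sub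
      (((Real.hasDerivAt_exp x).sub_const 1).const_mul 2)
  have hmono : Monotone fun x : ℝ => x * (Real.exp x + 1) - 2 * (Real.exp x - 1) := by
    refine monotone_of_deriv_nonneg (fun x => (hder x).differentiableAt) fun x => ?_
    rw [(hder x).deriv]
    have h := mul_le_mul_of_nonneg_right (Real.one_sub_le_exp_neg x) (Real.exp_pos x).le
    rw [← Real.exp_add, neg_add_cancel, Real.exp_zero] at h
    linarith
  have := hmono hd
  simp at this
  linarith

/-- The logarithmic mean of `exp u` and `exp v` is at most their arithmetic mean. -/
lemma two_mul_sub_mul_exp_sub_le (u v : ℝ) :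
    2 * ((u - v) * (Real.exp u - Real.exp v)) ≤ (u - v) ^ 2 * (Real.exp u + Real.exp v) := by
  wlog h : v ≤ u generalizing u v
  · have := this v u (le_of_not_ge h)
    linarith
  have key := two_mul_exp_sub_one_le (sub_nonneg.2 h)
  have he : Real.exp u = Real.exp (u - v) * Real.exp v := by
    rw [← Real.exp_add, sub_add_cancel]
  have hm := mul_le_mul_of_nonneg_left key
    (mul_nonneg (sub_nonneg.2 h) (Real.exp_pos v).le)
  rw [he]
  linarith

lemma abs_sub_mul_exp_sub_le (θ x y : ℝ) :
    |(x - y) * (Real.exp (θ * x) - Real.exp (θ * y))| ≤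
      |θ| / 2 * ((x - y) ^ 2 * (Real.exp (θ * x) + Real.exp (θ * y))) := by
  rcases eq_or_ne θ 0 with rfl | hθ
  · simp
  have key := two_mul_sub_mul_exp_sub_le (θ * x) (θ * y)
  have hnn : 0 ≤ (θ * x - θ * y) * (Real.exp (θ * x) - Real.exp (θ * y)) := by
    rcases le_total (θ * x) (θ * y) with h | h
    · exact mul_nonneg_of_nonpos_of_nonpos (sub_nonpos.2 h)
        (sub_nonpos.2 (Real.exp_le_exp.2 h))
    · exact mul_nonneg (sub_nonneg.2 h) (sub_nonneg.2 (Real.exp_le_exp.2 h))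
  have hpos : 0 < |θ| := abs_pos.2 hθ
  refine le_of_mul_le_mul_left ?_ hpos
  rw [← abs_mul, ← mul_assoc, mul_sub θ x y, abs_of_nonneg hnn]
  calc _ ≤ (θ * x - θ * y) ^ 2 * (Real.exp (θ * x) + Real.exp (θ * y)) / 2 := by linarith
    _ = |θ| ^ 2 * (x - y) ^ 2 * (Real.exp (θ * x) + Real.exp (θ * y)) / 2 := by
        rw [sq_abs]; ring
    _ = _ := by ring

/-- Exchangeability of the pair: right multiplication by a transposition is an involution of the
permutations. -/
lemma sum_sum_sum_mul_swap_comm {n : ℕ}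
    (F : Equiv.Perm (Fin n) → Equiv.Perm (Fin n) → ℝ) :
    ∑ π : Equiv.Perm (Fin n), ∑ i, ∑ j, F (π * Equiv.swap i j) π =
      ∑ π : Equiv.Perm (Fin n), ∑ i, ∑ j, F π (π * Equiv.swap i j) := by
  rw [Finset.sum_comm, Finset.sum_comm (f := fun π i => ∑ j, F π (π * Equiv.swap i j))]
  refine Finset.sum_congr rfl fun i _ => ?_
  rw [Finset.sum_comm, Finset.sum_comm (f := fun π j => F π (π * Equiv.swap i j))]
  refine Finset.sum_congr rfl fun j _ => ?_
  rw [← Equiv.sum_comp (Equiv.mulRight (Equiv.swap i j))]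
  simp [mul_assoc]

lemma abs_sum_sub_mul_exp_le {n : ℕ} [NeZero n] {a : Fin n → Fin n → ℝ}
    (ha : ∀ i j, 0 ≤ a i j) (ha' : ∀ i j, a i j ≤ 1) (θ : ℝ) :
    |∑ π : Equiv.Perm (Fin n),
        (permutedSum a π - permutedMean a) * Real.exp (θ * permutedSum a π)| ≤
      |θ| * ∑ π : Equiv.Perm (Fin n),
        (permutedSum a π + permutedMean a) * Real.exp (θ * permutedSum a π) := by
  have hn : (0 : ℝ) < n := by exact_mod_cast Nat.pos_of_ne_zero (NeZero.ne n)
  set Z : Equiv.Perm (Fin n) → ℝ := permutedSum a with hZ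
  set w : Equiv.Perm (Fin n) → ℝ := fun π => Real.exp (θ * Z π) with hw
  -- Averaging the identity with its image under exchange replaces `w π` by the difference `w π - w
  -- π'`, which is of order `θ`.
  have hlin : 4 * n * ∑ π, (Z π - permutedMean a) * w π =
      ∑ π, ∑ i, ∑ j, (Z π - Z (π * Equiv.swap i j)) * (w π - w (π * Equiv.swap i j)) := by
    have h1 : 2 * n * ∑ π, (Z π - permutedMean a) * w π =
        ∑ π, ∑ i, ∑ j, (Z π - Z (π * Equiv.swap i j)) * w π := by
      rw [Finset.mul_sum]
      refine Finset.sum_congr rfl fun π _ => ?_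
      simp only [← Finset.sum_mul]
      rw [sum_sum_permutedSum_sub]
      ring
    have h2 := sum_sum_sum_mul_swap_comm fun π σ => (Z π - Z σ) * w π
    have h3 : ∑ π, ∑ i, ∑ j, (Z (π * Equiv.swap i j) - Z π) * w (π * Equiv.swap i j) +
        ∑ π, ∑ i, ∑ j, (Z π - Z (π * Equiv.swap i j)) * w π =
        ∑ π, ∑ i, ∑ j, (Z π - Z (π * Equiv.swap i j)) * (w π - w (π * Equiv.swap i j)) := by
      simp only [← Finset.sum_add_distrib]
      refine Finset.sum_congr rfl fun π _ => Finset.sum_congr rfl fun i _ =>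
        Finset.sum_congr rfl fun j _ => ?_
      ring
    rw [← h3, h2, ← h1]
    ring
  have hsq : ∑ π, ∑ i, ∑ j, (Z π - Z (π * Equiv.swap i j)) ^ 2 *
        (w π + w (π * Equiv.swap i j)) ≤
      8 * n * ∑ π, (Z π + permutedMean a) * w π := by
    have h1 : ∑ π, ∑ i, ∑ j, (Z π - Z (π * Equiv.swap i j)) ^ 2 * w π ≤
        4 * n * ∑ π, (Z π + permutedMean a) * w π := by
      rw [Finset.mul_sum]
      refine Finset.sum_le_sum fun π _ => ?_
      simp only [← Finset.sum_mul]
      rw [← mul_assoc]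
      exact mul_le_mul_of_nonneg_right (sum_sum_permutedSum_sub_sq_le ha ha' π)
        (Real.exp_pos _).le
    have h2 := sum_sum_sum_mul_swap_comm fun π σ => (Z π - Z σ) ^ 2 * w π
    have h3 : ∑ π, ∑ i, ∑ j, (Z (π * Equiv.swap i j) - Z π) ^ 2 * w (π * Equiv.swap i j) +
        ∑ π, ∑ i, ∑ j, (Z π - Z (π * Equiv.swap i j)) ^ 2 * w π =
        ∑ π, ∑ i, ∑ j, (Z π - Z (π * Equiv.swap i j)) ^ 2 *
          (w π + w (π * Equiv.swap i j)) := by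
      simp only [← Finset.sum_add_distrib]
      refine Finset.sum_congr rfl fun π _ => Finset.sum_congr rfl fun i _ =>
        Finset.sum_congr rfl fun j _ => ?_
      ring
    rw [← h3, h2]
    linarith
  have habs : |∑ π, ∑ i, ∑ j,
        (Z π - Z (π * Equiv.swap i j)) * (w π - w (π * Equiv.swap i j))| ≤
      |θ| / 2 * ∑ π, ∑ i, ∑ j, (Z π - Z (π * Equiv.swap i j)) ^ 2 *
        (w π + w (π * Equiv.swap i j)) := by
    simp only [Finset.mul_sum]
    refine (Finset.abs_sum_le_sum_abs _ _).trans (Finset.sum_le_sum fun π _ => ?_)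
    refine (Finset.abs_sum_le_sum_abs _ _).trans (Finset.sum_le_sum fun i _ => ?_)
    refine (Finset.abs_sum_le_sum_abs _ _).trans (Finset.sum_le_sum fun j _ => ?_)
    exact abs_sub_mul_exp_sub_le θ _ _
  rw [← hlin, abs_mul, abs_of_pos (by positivity : (0 : ℝ) < 4 * n)] at habs
  refine le_of_mul_le_mul_left ?_ (by positivity : (0 : ℝ) < 4 * n)
  refine habs.trans ((mul_le_mul_of_nonneg_left hsq (by positivity)).trans_eq ?_)
  ring

/-! ### Integrating the differential inequality -/

/-- Grönwall's argument: `M * exp(-c)` is antitone. -/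
lemma le_mul_exp_of_deriv_le_mul {M M' c c' : ℝ → ℝ} {θ : ℝ} (hθ : 0 ≤ θ)
    (hM : ∀ x ∈ Set.Icc 0 θ, HasDerivAt M (M' x) x)
    (hc : ∀ x ∈ Set.Icc 0 θ, HasDerivAt c (c' x) x)
    (h : ∀ x ∈ Set.Icc 0 θ, M' x ≤ c' x * M x) (hc0 : c 0 = 0) :
    M θ ≤ M 0 * Real.exp (c θ) := by
  have hder : ∀ x ∈ Set.Icc 0 θ, HasDerivAt (fun x => M x * Real.exp (-c x))
      (M' x * Real.exp (-c x) + M x * (Real.exp (-c x) * -c' x)) x :=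
    fun x hx => (hM x hx).mul (hc x hx).neg.exp
  have hanti : AntitoneOn (fun x => M x * Real.exp (-c x)) (Set.Icc 0 θ) := by
    refine antitoneOn_of_deriv_nonpos (convex_Icc 0 θ)
      (fun x hx => (hder x hx).continuousAt.continuousWithinAt)
      (fun x hx => (hder x (interior_subset hx)).differentiableAt.differentiableWithinAt)
      fun x hx => ?_
    have hx := interior_subset hx
    rw [(hder x hx).deriv]
    have := mul_le_mul_of_nonneg_right (h x hx) (Real.exp_pos (-c x)).le
    linarith
  have h0 := hanti (Set.left_mem_Icc.2 hθ) (Set.right_mem_Icc.2 hθ) hθ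
  simp only [hc0, neg_zero, Real.exp_zero, mul_one] at h0
  have := mul_le_mul_of_nonneg_right h0 (Real.exp_pos (c θ)).le
  rwa [mul_assoc, ← Real.exp_add, neg_add_cancel, Real.exp_zero, mul_one] at this

/-- The sum over all permutations of the exponential of `θ` times the centred permuted sum. -/
noncomputable def expSum {n : ℕ} (a : Fin n → Fin n → ℝ) (θ : ℝ) : ℝ :=
  ∑ π : Equiv.Perm (Fin n), Real.exp (θ * (permutedSum a π - permutedMean a))

/-- The derivative of `expSum`. -/
noncomputable def expSumDeriv {n : ℕ} (a : Fin n → Fin n → ℝ) (θ : ℝ) : ℝ :=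
  ∑ π : Equiv.Perm (Fin n), (permutedSum a π - permutedMean a) *
    Real.exp (θ * (permutedSum a π - permutedMean a))

lemma hasDerivAt_expSum {n : ℕ} (a : Fin n → Fin n → ℝ) (θ : ℝ) :
    HasDerivAt (expSum a) (expSumDeriv a θ) θ := by
  unfold expSum expSumDeriv
  refine HasDerivAt.fun_sum fun π _ => ?_
  have := ((hasDerivAt_id θ).mul_const (permutedSum a π - permutedMean a)).exp
  simpa [mul_comm] using this

lemma expSum_zero {n : ℕ} (a : Fin n → Fin n → ℝ) : expSum a 0 = n.factorial := by
  simp [expSum, Fintype.card_perm]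

lemma expSum_nonneg {n : ℕ} (a : Fin n → Fin n → ℝ) (θ : ℝ) : 0 ≤ expSum a θ :=
  Finset.sum_nonneg fun _ _ => (Real.exp_pos _).le

/-- Splitting `Z + μ = (Z - μ) + 2μ` closes the inequality in terms of `M` and `M'` alone. -/
lemma abs_expSumDeriv_le {n : ℕ} [NeZero n] {a : Fin n → Fin n → ℝ}
    (ha : ∀ i j, 0 ≤ a i j) (ha' : ∀ i j, a i j ≤ 1) (θ : ℝ) :
    |expSumDeriv a θ| ≤ |θ| * (expSumDeriv a θ + 2 * permutedMean a * expSum a θ) := by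
  have key := mul_le_mul_of_nonneg_right (abs_sum_sub_mul_exp_le ha ha' θ)
    (Real.exp_pos (-(θ * permutedMean a))).le
  have hexp : ∀ π : Equiv.Perm (Fin n),
      Real.exp (θ * permutedSum a π) * Real.exp (-(θ * permutedMean a)) =
        Real.exp (θ * (permutedSum a π - permutedMean a)) := fun π => by
    rw [← Real.exp_add]
    ring_nf
  rw [← abs_of_pos (Real.exp_pos (-(θ * permutedMean a))), ← abs_mul,
    abs_of_pos (Real.exp_pos (-(θ * permutedMean a))), mul_assoc, Finset.sum_mul,
    Finset.sum_mul] at key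
  simp only [mul_assoc, hexp] at key
  refine key.trans_eq ?_
  unfold expSumDeriv expSum
  congr 1
  rw [Finset.mul_sum, ← Finset.sum_add_distrib]
  refine Finset.sum_congr rfl fun π _ => ?_
  ring

lemma expSum_le_of_nonneg {n : ℕ} [NeZero n] {a : Fin n → Fin n → ℝ}
    (ha : ∀ i j, 0 ≤ a i j) (ha' : ∀ i j, a i j ≤ 1) {θ : ℝ} (hθ : 0 ≤ θ) (hθ' : θ < 1) :
    expSum a θ ≤ n.factorial * Real.exp (permutedMean a * θ ^ 2 / (1 - θ)) := by
  have hμ := permutedMean_nonneg ha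
  rw [← expSum_zero a]
  refine le_mul_exp_of_deriv_le_mul (M' := expSumDeriv a)
    (c := fun x => permutedMean a * x ^ 2 / (1 - x))
    (c' := fun x => permutedMean a * (x * (2 - x)) / (1 - x) ^ 2) hθ
    (fun x _ => hasDerivAt_expSum a x) (fun x hx => ?_) (fun x hx => ?_) (by simp)
  · have hx1 : 1 - x ≠ 0 := by linarith [hx.2]
    have := (((hasDerivAt_id x).pow 2).const_mul (permutedMean a)).div
      ((hasDerivAt_id x).const_sub 1) hx1
    refine this.congr_deriv ?_
    simp only [id, Pi.pow_apply]
    field_simp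
    norm_num
    ring
  · have hx1 : 0 < 1 - x := by linarith [hx.2]
    have h1 := (le_abs_self _).trans (abs_expSumDeriv_le ha ha' x)
    rw [abs_of_nonneg hx.1] at h1
    have hS := expSum_nonneg a x
    rw [div_mul_eq_mul_div, le_div_iff₀ (by positivity)]
    have h2 : expSumDeriv a x * (1 - x) ≤ x * (2 * permutedMean a * expSum a x) := by linarith
    have h3 := mul_le_mul_of_nonneg_right h2 hx1.le
    -- The inequality gives the rate `2μx/(1 - x)`; the larger `c'` has the explicit primitive
    -- `μx²/(1 - x)`, and this term is the slack.
    have h4 : 0 ≤ x ^ 2 * (permutedMean a * expSum a x) := by positivity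
    linarith

lemma expSum_neg_le {n : ℕ} [NeZero n] {a : Fin n → Fin n → ℝ}
    (ha : ∀ i j, 0 ≤ a i j) (ha' : ∀ i j, a i j ≤ 1) {θ : ℝ} (hθ : 0 ≤ θ) :
    expSum a (-θ) ≤ n.factorial * Real.exp (permutedMean a * θ ^ 2) := by
  have hμ := permutedMean_nonneg ha
  have h0 : (n.factorial : ℝ) = expSum a (-0) := by rw [neg_zero, expSum_zero]
  rw [h0]
  refine le_mul_exp_of_deriv_le_mul (M := fun x => expSum a (-x))
    (M' := fun x => -expSumDeriv a (-x))
    (c := fun x => permutedMean a * x ^ 2)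
    (c' := fun x => permutedMean a * (2 * x)) hθ
    (fun x _ => ?_) (fun x hx => ?_) (fun x hx => ?_) (by simp)
  · have := (hasDerivAt_expSum a (-x)).scomp x (hasDerivAt_neg x)
    rwa [neg_one_smul] at this
  · simpa using ((hasDerivAt_id x).pow 2).const_mul (permutedMean a)
  · have h1 := (neg_le_abs _).trans (abs_expSumDeriv_le ha ha' (-x))
    rw [abs_neg, abs_of_nonneg hx.1] at h1
    have hS := expSum_nonneg a (-x)
    have hx0 := hx.1
    -- The inequality gives the rate `2μx/(1 + x)`; the factor `1/(1 + x)` is discarded.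
    have h4 : 0 ≤ x * (permutedMean a * (2 * x)) * expSum a (-x) := by positivity
    refine le_of_mul_le_mul_right ?_ (by linarith : 0 < 1 + x)
    linarith

/-! ### Chernoff bounds around the mean -/

lemma IsUniformPermutation.measureReal_le {n : ℕ} {Ω : Type*} [MeasurableSpace Ω]
    {P : Measure Ω} {Perm : Ω → Equiv.Perm (Fin n)}
    (hPerm : IsUniformPermutation P Perm) (p : Equiv.Perm (Fin n) → Prop)
    {g : Equiv.Perm (Fin n) → ℝ} (hg : ∀ π, 0 ≤ g π) (hpg : ∀ π, p π → 1 ≤ g π) :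
    P.real {ω | p (Perm ω)} ≤ (∑ π, g π) / n.factorial := by
  classical
  have hset : {ω | p (Perm ω)} =
      ⋃ π ∈ Finset.univ.filter p, {ω | Perm ω = π} := by
    ext ω
    simp
  rw [hset]
  refine (measureReal_biUnion_finset_le _ _).trans ?_
  simp only [hPerm.prob_eq]
  rw [Finset.sum_div]
  refine (Finset.sum_le_sum fun π hπ => ?_).trans
    (Finset.sum_le_sum_of_subset_of_nonneg (Finset.filter_subset p _) fun π _ _ => ?_)
  · exact div_le_div_of_nonneg_right (hpg π (Finset.mem_filter.1 hπ).2) (by positivity)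
  · exact div_nonneg (hg π) (by positivity)

lemma IsUniformPermutation.measureReal_mean_add_le {n : ℕ} [NeZero n] {Ω : Type*}
    [MeasurableSpace Ω] {P : Measure Ω} {Perm : Ω → Equiv.Perm (Fin n)}
    (hPerm : IsUniformPermutation P Perm) {a : Fin n → Fin n → ℝ}
    (ha : ∀ i j, 0 ≤ a i j) (ha' : ∀ i j, a i j ≤ 1) (hμ : 0 < permutedMean a)
    {s : ℝ} (hs : 0 ≤ s) :
    P.real {ω | permutedMean a + s ≤ permutedSum a (Perm ω)} ≤
      Real.exp (-(s ^ 2 / (4 * permutedMean a + 2 * s))) := by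
  set μ := permutedMean a with hμdef
  -- Not the exact optimiser: this `θ` makes `μθ²/(1 - θ)` equal to `θs/2`, leaving the exponent
  -- `-θs/2`.
  set θ := s / (2 * μ + s) with hθ
  have hden : 0 < 2 * μ + s := by linarith
  have hθ0 : 0 ≤ θ := by positivity
  have hθ1 : θ < 1 := by rw [hθ, div_lt_one hden]; linarith
  refine (hPerm.measureReal_le (fun π => μ + s ≤ permutedSum a π)
    (g := fun π => Real.exp (-(θ * s)) * Real.exp (θ * (permutedSum a π - μ)))
    (fun π => by positivity) fun π hπ => ?_).trans ?_
  · rw [← Real.exp_add]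
    refine Real.one_le_exp ?_
    have := mul_le_mul_of_nonneg_left (by linarith : s ≤ permutedSum a π - μ) hθ0
    linarith
  · rw [← Finset.mul_sum, div_le_iff₀ (by positivity)]
    refine (mul_le_mul_of_nonneg_left (expSum_le_of_nonneg ha ha' hθ0 hθ1)
      (Real.exp_pos _).le).trans_eq ?_
    rw [mul_left_comm, ← Real.exp_add, mul_comm]
    congr 2
    have h1 : 1 - θ = 2 * μ / (2 * μ + s) := by
      rw [hθ]
      field_simp
      ring
    rw [← hμdef, h1, hθ]
    have : 4 * μ + 2 * s ≠ 0 := by positivity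
    field_simp
    ring

lemma IsUniformPermutation.measureReal_le_mean_sub {n : ℕ} [NeZero n] {Ω : Type*}
    [MeasurableSpace Ω] {P : Measure Ω} {Perm : Ω → Equiv.Perm (Fin n)}
    (hPerm : IsUniformPermutation P Perm) {a : Fin n → Fin n → ℝ}
    (ha : ∀ i j, 0 ≤ a i j) (ha' : ∀ i j, a i j ≤ 1) (hμ : 0 < permutedMean a)
    {s : ℝ} (hs : 0 ≤ s) :
    P.real {ω | permutedSum a (Perm ω) ≤ permutedMean a - s} ≤
      Real.exp (-(s ^ 2 / (4 * permutedMean a))) := by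
  set μ := permutedMean a with hμdef
  -- The minimiser of `-θs + μθ²`.
  set θ := s / (2 * μ) with hθ
  have hθ0 : 0 ≤ θ := by positivity
  refine (hPerm.measureReal_le (fun π => permutedSum a π ≤ μ - s)
    (g := fun π => Real.exp (-(θ * s)) * Real.exp (-θ * (permutedSum a π - μ)))
    (fun π => by positivity) fun π hπ => ?_).trans ?_
  · rw [← Real.exp_add]
    refine Real.one_le_exp ?_
    have := mul_le_mul_of_nonneg_left (by linarith : s ≤ μ - permutedSum a π) hθ0
    linarith
  · rw [← Finset.mul_sum, div_le_iff₀ (by positivity)]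
    refine (mul_le_mul_of_nonneg_left (expSum_neg_le ha ha' hθ0)
      (Real.exp_pos _).le).trans_eq ?_
    rw [mul_left_comm, ← Real.exp_add, mul_comm]
    congr 2
    rw [← hμdef, hθ]
    field_simp
    ring

/-! ### Gaussian tails for the square root -/

lemma IsUniformPermutation.measureReal_sqrt_mean_add_le {n : ℕ} [NeZero n] {Ω : Type*}
    [MeasurableSpace Ω] {P : Measure Ω} [IsFiniteMeasure P] {Perm : Ω → Equiv.Perm (Fin n)}
    (hPerm : IsUniformPermutation P Perm) {a : Fin n → Fin n → ℝ}
    (ha : ∀ i j, 0 ≤ a i j) (ha' : ∀ i j, a i j ≤ 1) (hμ : 0 < permutedMean a)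
    {t : ℝ} (ht : 0 ≤ t) :
    P.real {ω | √(permutedMean a) + t ≤ √(permutedSum a (Perm ω))} ≤
      Real.exp (-(t ^ 2 / 2)) := by
  have hb := Real.sqrt_pos.2 hμ
  have hsq := Real.sq_sqrt hμ.le
  set b := √(permutedMean a)
  -- The deviation `s = t(2b + t)` is chosen so that `μ + s = (b + t)²`.
  have hs : 0 ≤ t * (2 * b + t) := by positivity
  refine (measureReal_mono fun ω hω => ?_).trans
    ((hPerm.measureReal_mean_add_le ha ha' hμ hs).trans (Real.exp_le_exp.2 ?_))
  · have h1 : b + t ≤ √(permutedSum a (Perm ω)) := hω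
    have h2 := Real.sq_sqrt (permutedSum_nonneg ha (Perm ω))
    have h3 := pow_le_pow_left₀ (by positivity) h1 2
    simp only [Set.mem_ofPred_eq]
    linarith
  · rw [neg_le_neg_iff, ← hsq, div_le_div_iff₀ (by norm_num) (by positivity)]
    have : 0 ≤ t ^ 2 * (4 * b ^ 2 + 4 * b * t) := by positivity
    linarith

lemma IsUniformPermutation.measureReal_sqrt_le_mean_sub {n : ℕ} [NeZero n] {Ω : Type*}
    [MeasurableSpace Ω] {P : Measure Ω} [IsFiniteMeasure P] {Perm : Ω → Equiv.Perm (Fin n)}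
    (hPerm : IsUniformPermutation P Perm) {a : Fin n → Fin n → ℝ}
    (ha : ∀ i j, 0 ≤ a i j) (ha' : ∀ i j, a i j ≤ 1) (hμ : 0 < permutedMean a)
    {t : ℝ} (ht : 0 ≤ t) :
    P.real {ω | √(permutedSum a (Perm ω)) ≤ √(permutedMean a) - t} ≤
      Real.exp (-(t ^ 2 / 4)) := by
  have hb := Real.sqrt_pos.2 hμ
  have hsq := Real.sq_sqrt hμ.le
  set b := √(permutedMean a)
  rcases lt_or_ge b t with hbt | hbt
  · have : {ω | √(permutedSum a (Perm ω)) ≤ b - t} = ∅ :=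
      Set.eq_empty_of_forall_notMem fun ω hω => by
        rw [Set.mem_ofPred_eq] at hω
        linarith [Real.sqrt_nonneg (permutedSum a (Perm ω))]
    rw [this, measureReal_empty]
    positivity
  -- Here `μ - s = (b - t)²`, and `t ≤ b` gives `s ≥ tb`, hence `s²/(4b²) ≥ t²/4`.
  have hs : 0 ≤ t * (2 * b - t) := mul_nonneg ht (by linarith)
  refine (measureReal_mono fun ω hω => ?_).trans
    ((hPerm.measureReal_le_mean_sub ha ha' hμ hs).trans (Real.exp_le_exp.2 ?_))
  · have h1 : √(permutedSum a (Perm ω)) ≤ b - t := hω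
    have h2 := Real.sq_sqrt (permutedSum_nonneg ha (Perm ω))
    have h3 := pow_le_pow_left₀ (Real.sqrt_nonneg _) h1 2
    simp only [Set.mem_ofPred_eq]
    linarith
  · rw [neg_le_neg_iff, ← hsq, div_le_div_iff₀ (by norm_num) (by positivity), mul_pow]
    have := mul_le_mul_of_nonneg_left
      (pow_le_pow_left₀ hb.le (by linarith : b ≤ 2 * b - t) 2) (sq_nonneg t)
    linarith

/-! ### From the mean to a median -/

/-- Cauchy–Schwarz; it lets the two Gaussian exponents combine by adding their denominators. -/
lemma sq_div_add_le {α β : ℝ} (hα : 0 < α) (hβ : 0 < β) (x y : ℝ) :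
    (x + y) ^ 2 / (α + β) ≤ x ^ 2 / α + y ^ 2 / β := by
  rw [div_add_div _ _ hα.ne' hβ.ne', div_le_div_iff₀ (by positivity) (by positivity)]
  nlinarith [sq_nonneg (β * x - α * y)]

/-- Gaussian tails around an arbitrary point give Gaussian tails around a median. -/
lemma measureReal_median_add_le {Ω : Type*} [MeasurableSpace Ω] {P : Measure Ω}
    [IsProbabilityMeasure P] {X : Ω → ℝ} {b q α β : ℝ} (hα : 0 < α) (hβ : 0 < β)
    (hU : ∀ t, 0 ≤ t → P.real {ω | b + t ≤ X ω} ≤ Real.exp (-(t ^ 2 / α)))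
    (hL : ∀ t, 0 ≤ t → P.real {ω | X ω ≤ b - t} ≤ Real.exp (-(t ^ 2 / β)))
    (hq : 1 / 2 ≤ P.real {ω | X ω ≤ q}) {t : ℝ} (ht : 0 ≤ t) :
    P.real {ω | q + t ≤ X ω} ≤ 2 * Real.exp (-(t ^ 2 / (α + β))) := by
  rcases le_total b q with hbq | hbq
  · have h := hU (q + t - b) (by linarith)
    rw [add_sub_cancel] at h
    have h2 : Real.exp (-((q + t - b) ^ 2 / α)) ≤ Real.exp (-(t ^ 2 / (α + β))) := by
      rw [Real.exp_le_exp, neg_le_neg_iff]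
      exact div_le_div₀ (sq_nonneg _) (pow_le_pow_left₀ ht (by linarith) 2) hα (by linarith)
    linarith [Real.exp_pos (-(t ^ 2 / (α + β)))]
  · have hd := hL (b - q) (by linarith)
    rw [sub_sub_cancel] at hd
    -- The lower tail has mass at least `1/2` at `q`, so `q` cannot lie far below `b`. This factor,
    -- at least `1`, supplies the missing part of the exponent.
    have hd2 : 1 ≤ 2 * Real.exp (-((b - q) ^ 2 / β)) := by linarith
    rcases le_total (b - q) t with htd | htd
    · have h := hU (t - (b - q)) (by linarith)
      have he : b + (t - (b - q)) = q + t := by ring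
      rw [he] at h
      refine h.trans ((le_mul_of_one_le_left (Real.exp_pos _).le hd2).trans ?_)
      rw [mul_assoc, ← Real.exp_add]
      refine mul_le_mul_of_nonneg_left (Real.exp_le_exp.2 ?_) two_pos.le
      have := sq_div_add_le hα hβ (t - (b - q)) (b - q)
      rw [sub_add_cancel] at this
      linarith
    · refine measureReal_le_one.trans (hd2.trans ?_)
      refine mul_le_mul_of_nonneg_left (Real.exp_le_exp.2 (neg_le_neg ?_)) two_pos.le
      exact div_le_div₀ (sq_nonneg _) (pow_le_pow_left₀ ht htd 2) hβ (by linarith)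

lemma permutedMean_pos {n : ℕ} [NeZero n] {a : Fin n → Fin n → ℝ}
    (ha : ∀ i j, 0 ≤ a i j) (h : ∃ i j, a i j ≠ 0) : 0 < permutedMean a := by
  obtain ⟨i, j, hij⟩ := h
  refine div_pos ?_ (by exact_mod_cast Nat.pos_of_ne_zero (NeZero.ne n))
  exact Finset.sum_pos' (fun _ _ => Finset.sum_nonneg fun _ _ => ha _ _)
    ⟨i, Finset.mem_univ _, Finset.sum_pos' (fun _ _ => ha _ _)
      ⟨j, Finset.mem_univ _, (ha i j).lt_of_ne' hij⟩⟩

lemma le_maxEntry {n : ℕ} [NeZero n] (a : Fin n → Fin n → ℝ) (i j : Fin n) :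
    a i j ≤ maxEntry a :=
  Finset.le_sup' (fun p : Fin n × Fin n => a p.1 p.2) (Finset.mem_univ (i, j))

/-- Concentration of the square root of the permuted sum around its median, with entries not all
zero and the constant `6` in the exponent. -/
lemma IsUniformPermutation.measureReal_sqrt_median_le {n : ℕ} [NeZero n] {Ω : Type*}
    [MeasurableSpace Ω] {P : Measure Ω} [IsProbabilityMeasure P]
    {Perm : Ω → Equiv.Perm (Fin n)} (hPerm : IsUniformPermutation P Perm)
    {a : Fin n → Fin n → ℝ} (ha : ∀ i j, 0 ≤ a i j) (hne : ∃ i j, a i j ≠ 0) {m : ℝ}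
    (hm : IsMedian P (fun ω => permutedSum a (Perm ω)) m) {t : ℝ} (ht : 0 ≤ t) :
    P.real {ω | √m + t * √(maxEntry a) ≤ √(permutedSum a (Perm ω))} ≤
        2 * Real.exp (-(t ^ 2 / 6)) ∧
      P.real {ω | √(permutedSum a (Perm ω)) ≤ √m - t * √(maxEntry a)} ≤
        2 * Real.exp (-(t ^ 2 / 6)) := by
  obtain ⟨i₀, j₀, h₀⟩ := hne
  have hM : 0 < maxEntry a := ((ha i₀ j₀).lt_of_ne' h₀).trans_le (le_maxEntry a i₀ j₀)
  have hr : 0 < √(maxEntry a) := Real.sqrt_pos.2 hM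
  set c : Fin n → Fin n → ℝ := fun i j => a i j / maxEntry a with hc
  have hc0 : ∀ i j, 0 ≤ c i j := fun i j => div_nonneg (ha i j) hM.le
  have hc1 : ∀ i j, c i j ≤ 1 := fun i j => div_le_one_of_le₀ (le_maxEntry a i j) hM.le
  have hμ : 0 < permutedMean c := permutedMean_pos hc0 ⟨i₀, j₀, div_ne_zero h₀ hM.ne'⟩
  have hsqrt : ∀ π, √(permutedSum c π) = √(permutedSum a π) / √(maxEntry a) := fun π => by
    rw [← Real.sqrt_div (permutedSum_nonneg ha π)]
    simp only [permutedSum, hc, Finset.sum_div]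
  have hU := fun t (ht : (0 : ℝ) ≤ t) => hPerm.measureReal_sqrt_mean_add_le hc0 hc1 hμ ht
  have hL := fun t (ht : (0 : ℝ) ≤ t) => hPerm.measureReal_sqrt_le_mean_sub hc0 hc1 hμ ht
  constructor
  · have hq : 1 / 2 ≤ P.real {ω | √(permutedSum c (Perm ω)) ≤ √m / √(maxEntry a)} :=
      hm.2.trans (measureReal_mono fun ω hω => by
        simp only [Set.mem_ofPred_eq, hsqrt] at hω ⊢
        exact div_le_div_of_nonneg_right (Real.sqrt_le_sqrt hω) hr.le)
    have key := measureReal_median_add_le two_pos four_pos hU hL hq ht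
    norm_num at key
    refine (measureReal_mono fun ω hω => ?_).trans key
    simp only [Set.mem_ofPred_eq, hsqrt] at hω ⊢
    rwa [le_div_iff₀ hr, add_mul, div_mul_cancel₀ _ hr.ne']
  · have hq : 1 / 2 ≤ P.real {ω | -√(permutedSum c (Perm ω)) ≤ -(√m / √(maxEntry a))} :=
      hm.1.trans (measureReal_mono fun ω hω => by
        simp only [Set.mem_ofPred_eq, hsqrt, neg_le_neg_iff] at hω ⊢
        exact div_le_div_of_nonneg_right (Real.sqrt_le_sqrt hω) hr.le)
    -- The lower tail is the upper tail of the negated variable, with the two tail constants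
    -- exchanged.
    have key := measureReal_median_add_le (X := fun ω => -√(permutedSum c (Perm ω)))
      (b := -√(permutedMean c)) four_pos two_pos
      (fun t ht => (measureReal_mono fun ω hω => by
        simp only [Set.mem_ofPred_eq] at hω ⊢; linarith).trans (hL t ht))
      (fun t ht => (measureReal_mono fun ω hω => by
        simp only [Set.mem_ofPred_eq] at hω ⊢; linarith).trans (hU t ht)) hq ht
    norm_num at key
    refine (measureReal_mono fun ω hω => ?_).trans key
    simp only [Set.mem_ofPred_eq, hsqrt] at hω ⊢
    have := div_le_div_of_nonneg_right hω hr.le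
    rw [sub_div, mul_div_cancel_right₀ _ hr.ne'] at this
    linarith

theorem lemma2p1 {n : ℕ} [NeZero n] {Ω : Type*} [MeasurableSpace Ω]
    (P : Measure Ω) [IsProbabilityMeasure P]
    (a : Fin n → Fin n → ℝ) (ha : ∀ i j, 0 ≤ a i j)
    (Perm : Ω → Equiv.Perm (Fin n)) (hPerm : IsUniformPermutation P Perm)
    (Z : Ω → ℝ) (hZ : ∀ ω, Z ω = permutedSum a (Perm ω))
    (med : ℝ) (hmed : IsMedian P Z med)
    (t : ℝ) (ht : 0 < t) :
    ((∃ i j, a i j ≠ 0) →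
      P.real {ω | √(Z ω) ≥ √med + t * √(maxEntry a)} ≤ 2 * Real.exp (-t ^ 2 / 16) ∧
      P.real {ω | √(Z ω) ≤ √med - t * √(maxEntry a)} ≤ 2 * Real.exp (-t ^ 2 / 16)) ∧
    P.real {ω | |√(Z ω) - √med| > t * √(maxEntry a)} ≤ 4 * Real.exp (-t ^ 2 / 16) := by
  obtain rfl : Z = fun ω => permutedSum a (Perm ω) := funext hZ
  have hexp : 2 * Real.exp (-(t ^ 2 / 6)) ≤ 2 * Real.exp (-t ^ 2 / 16) :=
    mul_le_mul_of_nonneg_left (Real.exp_le_exp.2 (by linarith [sq_nonneg t])) two_pos.le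
  have htails : (∃ i j, a i j ≠ 0) →
      P.real {ω | √(permutedSum a (Perm ω)) ≥ √med + t * √(maxEntry a)} ≤
        2 * Real.exp (-t ^ 2 / 16) ∧
      P.real {ω | √(permutedSum a (Perm ω)) ≤ √med - t * √(maxEntry a)} ≤
        2 * Real.exp (-t ^ 2 / 16) := fun hne =>
    (hPerm.measureReal_sqrt_median_le ha hne hmed ht.le).imp
      (fun h => h.trans hexp) (fun h => h.trans hexp)
  refine ⟨htails, ?_⟩
  by_cases hne : ∃ i j, a i j ≠ 0
  · obtain ⟨h1, h2⟩ := htails hne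
    refine (measureReal_mono fun ω hω => ?_).trans
      ((measureReal_union_le _ _).trans ((add_le_add h1 h2).trans_eq (by ring)))
    simp only [Set.mem_ofPred_eq, Set.mem_union] at hω ⊢
    rcases lt_abs.1 hω with h | h
    · left; linarith
    · right; linarith
  · push Not at hne
    have hsum : ∀ π, permutedSum a π = 0 := fun π => by simp [permutedSum, hne]
    -- Enough to force `√med = 0`, since the real square root vanishes on nonpositive numbers; the
    -- strict inequality then makes the event empty.
    have hmed0 : med ≤ 0 := by
      by_contra hlt
      have := hmed.1
      simp only [hsum, hlt, Set.ofPred_false, measureReal_empty] at this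
      norm_num at this
    have hempty : {ω | |√(permutedSum a (Perm ω)) - √med| > t * √(maxEntry a)} = ∅ := by
      refine Set.eq_empty_of_forall_notMem fun ω hω => ?_
      rw [Set.mem_ofPred_eq, hsum, Real.sqrt_eq_zero_of_nonpos hmed0, Real.sqrt_zero, sub_zero, abs_zero] at hω
      exact absurd hω (not_lt.2 (mul_nonneg ht.le (Real.sqrt_nonneg _)))
    rw [hempty, measureReal_empty]
    positivity
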